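/- Let $p\ge 1$ and $N\ge 2$ be integers, let $s_n>0$ with $\sum_n s_n<\infty$, and for each $n$ let $\mathcal D^n\subset\mathbb R^p$ be a set of exactly $N$ points, one of which is $0$. Let $\kappa=\sup_n\max\{\|d-d'\|: d,d'\in\mathcal D^n\}$ and $\tau=\inf_n\min\{\|d-d'\|: d,d'\in\mathcal D^n,\ d\ne d'\}$, and write $R_n=\sum_{i>n}s_i$. Assume that $\kappa<\infty$, $\tau>0$ and $\sup_n \frac{\kappa R_n}{\tau s_n}<1$. For a sequence of scales $t=(t_i)$ and a sequence of digit sets $\mathcal E=(\mathcal E^i)$ put $C_{t,\mathcal E}=\{\sum_{i\ge1} t_i b_i : b_i\in\mathcal E^i\}$. Let $\mathcal H^d$ be the $d$-dimensional Hausdorff measure, and let $\mathcal P^d$ be the $d$-dimensional packing measure $$\mathcal P^d(E)=\inf\Big\{\sum_i \mathcal P^d_0(E_i): E\subseteq\bigcup_i E_i\Big\},$$ where $\mathcal P_0^d(E)$ is the limit as $\delta\to0$ of the supremum of $\sum_i |B_i|^d$ over all families of disjoint open balls $B_i$ with centres in $E$ and radii at most $\delta$ ($|B_i|$ is the diameter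 of $B_i$). A subsequence $(t_i)$ of $(s_n)$ is a sequence $t_i=s_{\pi(i)}$ with $\pi$ strictly increasing, and $\mathcal D\circ\pi$ denotes the sequence of digit sets $(\mathcal D^{\pi(i)})_i$. 1. If $0<\mathcal H^A(C_{s,\mathcal D})<\infty$, then for every $0<a\le A$ there is a subsequence $t=s\circ\pi$ of $s$ with $0<\mathcal H^a(C_{t,\mathcal E})<\infty$, both for $\mathcal E=\mathcal D\circ\pi$ and for $\mathcal E=\mathcal D$. 2. If $0<\mathcal P^B(C_{s,\mathcal D})<\infty$, then for every $0<b\le B$ there is a subsequence $t=s\circ\pi$ of $s$ with $0<\mathcal P^b(C_{t,\mathcal E})<\infty$, both for $\mathcal E=\mathcal D\circ\pi$ and for $\mathcal E=\mathcal D$. 3. If $0<\mathcal H^A(C_{s,\mathcal D})<\infty$ and $0<\mathcal P^B(C_{s,\mathcal D})<\infty$, then for all $0<a\le A$ and $0<b\le B$ with $a/A\le b/B$, where $b=B$ is allowed only if $a=A$, there is a single subsequence $t=s\circ\pi$ of $s$ with both $0<\mathcal H^a(C_{t,\mathcal E})<\infty$ and $0<\mathcal P^b(C_{t,\mathcal E})<\infty$,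 both for $\mathcal E=\mathcal D\circ\pi$ and for $\mathcal E=\mathcal D$. -/

import Mathlib

open MeasureTheory Set
open scoped ENNReal

noncomputable section

/-- The sum set `C_{s,D} = { ∑ i, s i • b i : b i ∈ D i }` of a sequence of scales `s` and a
sequence of digit sets `D` (indexed from `0`). -/
def sumSet {p : ℕ} (s : ℕ → ℝ) (D : ℕ → Finset (EuclideanSpace ℝ (Fin p))) :
    Set (EuclideanSpace ℝ (Fin p)) :=
  {x | ∃ b : ℕ → EuclideanSpace ℝ (Fin p), (∀ i, b i ∈ D i) ∧ HasSum (fun i => s i • b i) x}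

/-- The tail `R_n = ∑_{i > n} s_i`. -/
def tailSum (s : ℕ → ℝ) (n : ℕ) : ℝ := ∑' i, s (n + 1 + i)

/-- `κ = sup_n κ_n`, where `κ_n` is the largest distance between two digits of `D n`. -/
def digitKappa {p : ℕ} (D : ℕ → Finset (EuclideanSpace ℝ (Fin p))) : ℝ :=
  ⨆ n, Metric.diam (D n : Set (EuclideanSpace ℝ (Fin p)))

/-- `τ = inf_n τ_n`, where `τ_n` is the smallest distance between two distinct digits of `D n`. -/
def digitTau {p : ℕ} (D : ℕ → Finset (EuclideanSpace ℝ (Fin p))) : ℝ :=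
  ⨅ n, (D n : Set (EuclideanSpace ℝ (Fin p))).infsep

/-- The standing assumptions on the scales `s` and the digit sets `D`: every `D n` consists of `0`
and `N - 1` further points, the scales are positive and summable, `κ < ∞`, `τ > 0`, and
`sup_n κ R_n / (τ s_n) < 1`. -/
structure SumSetData {p : ℕ} (N : ℕ) (s : ℕ → ℝ)
    (D : ℕ → Finset (EuclideanSpace ℝ (Fin p))) : Prop where
  two_le : 2 ≤ N
  card_eq : ∀ n, (D n).card = N
  zero_mem : ∀ n, (0 : EuclideanSpace ℝ (Fin p)) ∈ D n
  pos : ∀ n, 0 < s n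
  summable : Summable s
  kappa_finite : BddAbove (range fun n => Metric.diam (D n : Set (EuclideanSpace ℝ (Fin p))))
  tau_pos : 0 < digitTau D
  decay : ∃ M : ℝ, M < 1 ∧ ∀ n, digitKappa D * tailSum s n / (digitTau D * s n) ≤ M

/-- `F` (a set of pairs (centre, radius)) is a `δ`-packing of `E`: a disjoint family of open balls
with centres in `E` and positive radii at most `δ`. -/
def IsPacking {X : Type*} [MetricSpace X] (δ : ℝ) (E : Set X) (F : Set (X × ℝ)) : Prop :=
  (∀ q ∈ F, q.1 ∈ E ∧ 0 < q.2 ∧ q.2 ≤ δ) ∧ F.PairwiseDisjoint fun q => Metric.ball q.1 q.2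

/-- `P^d_δ(E)`, the supremum of `∑ |B_i| ^ d` over all `δ`-packings of `E`. -/
def packingPreDelta {X : Type*} [MetricSpace X] (d : ℝ) (δ : ℝ) (E : Set X) : ℝ≥0∞ :=
  ⨆ (F : Set (X × ℝ)) (_ : IsPacking δ E F),
    ∑' q : F, Metric.ediam (Metric.ball (q : X × ℝ).1 (q : X × ℝ).2) ^ d

/-- The packing pre-measure `P^d_0(E) = lim_{δ → 0} P^d_δ(E)`; the limit is an infimum, since
`P^d_δ(E)` is monotone in `δ`. -/
def packingPre {X : Type*} [MetricSpace X] (d : ℝ) (E : Set X) : ℝ≥0∞ :=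
  ⨅ (δ : ℝ) (_ : 0 < δ), packingPreDelta d δ E

/-- The `d`-dimensional packing measure
`P^d(E) = inf { ∑ i, P^d_0(E_i) : E ⊆ ⋃ i, E_i }`. -/
def packingMeasure {X : Type*} [MetricSpace X] (d : ℝ) (E : Set X) : ℝ≥0∞ :=
  ⨅ (G : ℕ → Set X) (_ : E ⊆ ⋃ i, G i), ∑' i, packingPre d (G i)

end

open Filter Topology

/-! Let σ = (1 - M)τ. A cylinder of level n has diameter at most 2κ t_n, and points whose codes
first differ at n are at least σ t_n apart. Comparing with the uniform measure on codes, which gives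
such a cylinder mass N^(-n), shows that the Hausdorff measure is comparable to liminf N^n t_n^A and
the packing measure to limsup N^n t_n^B. With x_n = -log_N t_n, finiteness and positivity become
conditions on n - A x_n and n - B x_n (`hausdorffMeasure_mem_Ioo_iff`,
`packingMeasure_mem_Ioo_iff`). The digits enter only through κ and τ, so `D ∘ π` and `D` are treated
alike.

What remains concerns the monotone sequence x. Passing to π(i) ≈ (A/a)i rescales the index and turns
exponent A into a. For Hausdorff growth it is enough that π stays below this line and returns to it
at suitable times; for packing growth, that it stays above slope B/b and returns. Since B/b ≤ A/a,
one π can oscillate between both lines (`exists_strictMono_between_slopes`). -/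

/-- The standing assumptions on scales `t` and enumerated digits `e`, with explicit constants: the
digits have norm at most `κ`, distinct digits of one index are at least `τ` apart, and the tails of
`t` are small compared with its terms. -/
structure DigitSystem {V : Type*} [NormedAddCommGroup V] {N : ℕ} (κ τ M : ℝ) (t : ℕ → ℝ)
    (e : ℕ → Fin N → V) : Prop where
  two_le : 2 ≤ N
  pos : ∀ n, 0 < t n
  summable : Summable t
  norm_le : ∀ n k, ‖e n k‖ ≤ κ
  dist_le : ∀ n k l, dist (e n k) (e n l) ≤ κ
  le_dist : ∀ n k l, k ≠ l → τ ≤ dist (e n k) (e n l)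
  tau_pos : 0 < τ
  lt_one : M < 1
  decay : ∀ n, κ * tailSum t n ≤ M * (τ * t n)

/-- The point of the sum set with code `ω`. -/
noncomputable def codePoint {V : Type*} [NormedAddCommGroup V] [NormedSpace ℝ V] {N : ℕ} (t : ℕ → ℝ)
    (e : ℕ → Fin N → V) (ω : ℕ → Fin N) : V := ∑' i, t i • e i (ω i)

/-- The uniform product measure on the code space. -/
noncomputable def codeMeasure (N : ℕ) [NeZero N] : Measure (ℕ → Fin N) :=
  Measure.infinitePi fun _ => (PMF.uniformOfFintype (Fin N)).toMeasure

instance (N : ℕ) [NeZero N] : IsProbabilityMeasure (codeMeasure N) := by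
  unfold codeMeasure; infer_instance

lemma codeMeasure_cylinder (N : ℕ) [NeZero N] (n : ℕ) (w : ℕ → Fin N) :
    codeMeasure N {ω | ∀ i < n, ω i = w i} = ((N : ℝ≥0∞) ^ n)⁻¹ := by
  have h : {ω : ℕ → Fin N | ∀ i < n, ω i = w i} =
      Set.pi (Finset.range n : Set ℕ) fun i => {w i} := by
    ext ω; simp [Set.mem_pi]
  rw [h, codeMeasure, Measure.infinitePi_pi _ (fun i _ => measurableSet_singleton _)]
  simp [ENNReal.inv_pow]

/-! ### Geometry of cylinders -/

namespace DigitSystem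

variable {V : Type*} [NormedAddCommGroup V] {N : ℕ} {κ τ M : ℝ} {t : ℕ → ℝ}
  {e : ℕ → Fin N → V}

lemma tau_le_kappa (h : DigitSystem κ τ M t e) : τ ≤ κ := by
  have h2 := h.two_le
  have : (⟨0, by omega⟩ : Fin N) ≠ ⟨1, by omega⟩ := by simp
  exact (h.le_dist 0 _ _ this).trans (h.dist_le 0 _ _)

lemma kappa_pos (h : DigitSystem κ τ M t e) : 0 < κ := h.tau_pos.trans_le h.tau_le_kappa

lemma sigma_pos (h : DigitSystem κ τ M t e) : 0 < (1 - M) * τ :=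
  mul_pos (by linarith [h.lt_one]) h.tau_pos

lemma summable_tail (h : DigitSystem κ τ M t e) (n : ℕ) : Summable fun i => t (n + i) := by
  simpa [add_comm] using (summable_nat_add_iff n).2 h.summable

lemma tsum_tail (h : DigitSystem κ τ M t e) (n : ℕ) :
    ∑' i, t (n + i) = t n + tailSum t n := by
  rw [(h.summable_tail n).tsum_eq_zero_add, tailSum]
  simp only [add_zero]
  congr 1
  exact tsum_congr fun i => by congr 1; omega

lemma tailSum_le (h : DigitSystem κ τ M t e) (n : ℕ) : tailSum t n ≤ t n := by
  have h1 := h.decay n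
  have h2 : M * (τ * t n) ≤ κ * t n := by
    have h3 := mul_pos h.tau_pos (h.pos n)
    nlinarith [h.lt_one, mul_le_mul_of_nonneg_right h.tau_le_kappa (h.pos n).le]
  exact le_of_mul_le_mul_left (h1.trans h2) h.kappa_pos

lemma antitone (h : DigitSystem κ τ M t e) : Antitone t := by
  refine antitone_nat_of_succ_le fun n => le_trans ?_ (h.tailSum_le n)
  exact (h.summable_tail (n + 1)).le_tsum 0 fun _ _ => (h.pos _).le

lemma tsum_tail_le (h : DigitSystem κ τ M t e) (n : ℕ) : ∑' i, t (n + i) ≤ 2 * t n := by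
  rw [h.tsum_tail]; linarith [h.tailSum_le n]

lemma tendsto_zero (h : DigitSystem κ τ M t e) : Tendsto t atTop (𝓝 0) :=
  h.summable.tendsto_atTop_zero

/-- Matches a length to a scale. The index m records where an eventual bound on t starts, so that
the bound applies at n. -/
lemma exists_level (h : DigitSystem κ τ M t e) {c x : ℝ} {m : ℕ} (hx : 0 < x)
    (hc : 0 < c) (hm : x < c * t m) : ∃ n, m ≤ n ∧ c * t (n + 1) ≤ x ∧ x < c * t n := by
  have h1 : ∃ n, c * t n ≤ x := by
    have := h.tendsto_zero.const_mul c
    rw [mul_zero] at this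
    exact (this.eventually (ge_mem_nhds hx)).exists
  classical
  have h2 := Nat.find_spec h1
  have h3 : m < Nat.find h1 := by
    by_contra hlt
    have := mul_le_mul_of_nonneg_left (h.antitone (not_lt.1 hlt)) hc.le
    linarith
  obtain ⟨n, hn⟩ : ∃ n, Nat.find h1 = n + 1 := ⟨Nat.find h1 - 1, by omega⟩
  refine ⟨n, by omega, hn ▸ h2, not_le.1 (Nat.find_min h1 (by omega))⟩

variable [NormedSpace ℝ V] [CompleteSpace V]

lemma summable_smul (h : DigitSystem κ τ M t e) (ω : ℕ → Fin N) :
    Summable fun i => t i • e i (ω i) := by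
  refine Summable.of_norm_bounded (h.summable.mul_right κ) fun i => ?_
  rw [norm_smul, Real.norm_of_nonneg (h.pos i).le]
  exact mul_le_mul_of_nonneg_left (h.norm_le _ _) (h.pos i).le

lemma continuous_codePoint (h : DigitSystem κ τ M t e) : Continuous (codePoint t e) := by
  refine continuous_tsum (fun i => ?_) (h.summable.mul_right κ) fun i ω => ?_
  · exact continuous_const.smul (continuous_of_discreteTopology.comp (continuous_apply i))
  · rw [norm_smul, Real.norm_of_nonneg (h.pos i).le]
    exact mul_le_mul_of_nonneg_left (h.norm_le _ _) (h.pos i).le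

lemma codePoint_sub (h : DigitSystem κ τ M t e) {n : ℕ} {ω ω' : ℕ → Fin N}
    (hω : ∀ i < n, ω i = ω' i) :
    codePoint t e ω - codePoint t e ω' =
      ∑' i, t (n + i) • (e (n + i) (ω (n + i)) - e (n + i) (ω' (n + i))) := by
  have hs := (h.summable_smul ω).sub (h.summable_smul ω')
  rw [codePoint, codePoint, ← (h.summable_smul ω).tsum_sub (h.summable_smul ω'),
    ← hs.sum_add_tsum_nat_add n, Finset.sum_eq_zero, zero_add]
  · exact tsum_congr fun i => by rw [smul_sub, add_comm]
  · intro i hi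
    rw [hω i (Finset.mem_range.1 hi), sub_self]

omit [CompleteSpace V] in
lemma norm_tail_le (h : DigitSystem κ τ M t e) (n : ℕ) (ω ω' : ℕ → Fin N) :
    ‖∑' i, t (n + i) • (e (n + i) (ω (n + i)) - e (n + i) (ω' (n + i)))‖ ≤
      κ * ∑' i, t (n + i) := by
  rw [← tsum_mul_left]
  refine tsum_of_norm_bounded ((h.summable_tail n).mul_left κ).hasSum fun i => ?_
  rw [norm_smul, Real.norm_of_nonneg (h.pos _).le, mul_comm, ← dist_eq_norm]
  exact mul_le_mul_of_nonneg_right (h.dist_le _ _ _) (h.pos _).le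

lemma dist_codePoint_le (h : DigitSystem κ τ M t e) {n : ℕ} {ω ω' : ℕ → Fin N}
    (hω : ∀ i < n, ω i = ω' i) :
    dist (codePoint t e ω) (codePoint t e ω') ≤ 2 * κ * t n := by
  rw [dist_eq_norm, h.codePoint_sub hω]
  refine (h.norm_tail_le n ω ω').trans ?_
  nlinarith [mul_le_mul_of_nonneg_left (h.tsum_tail_le n) h.kappa_pos.le]

/-- The first differing digit contributes at least τ t_n, and all later ones together at most κ
times the tail, hence at most Mτ t_n. -/
lemma le_dist_codePoint (h : DigitSystem κ τ M t e) {n : ℕ} {ω ω' : ℕ → Fin N}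
    (hω : ∀ i < n, ω i = ω' i) (hn : ω n ≠ ω' n) :
    (1 - M) * τ * t n ≤ dist (codePoint t e ω) (codePoint t e ω') := by
  have hs : Summable fun i => t (n + i) • (e (n + i) (ω (n + i)) - e (n + i) (ω' (n + i))) := by
    have := (summable_nat_add_iff n).2 ((h.summable_smul ω).sub (h.summable_smul ω'))
    simpa only [smul_sub, add_comm] using this
  have h1 := h.codePoint_sub hω
  rw [hs.tsum_eq_zero_add] at h1
  have h2 := h.norm_tail_le (n + 1) ω ω'
  have h3 : ∑' i, t (n + (i + 1)) • (e (n + (i + 1)) (ω (n + (i + 1))) -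
      e (n + (i + 1)) (ω' (n + (i + 1)))) = ∑' i, t (n + 1 + i) • (e (n + 1 + i) (ω (n + 1 + i)) -
      e (n + 1 + i) (ω' (n + 1 + i))) := tsum_congr fun i => by
    rw [show n + (i + 1) = n + 1 + i by omega]
  rw [h3, add_zero] at h1
  have h4 : τ * t n ≤ ‖t n • (e n (ω n) - e n (ω' n))‖ := by
    rw [norm_smul, Real.norm_of_nonneg (h.pos _).le, mul_comm, ← dist_eq_norm]
    exact mul_le_mul_of_nonneg_left (h.le_dist _ _ _ hn) (h.pos _).le
  rw [dist_eq_norm, h1]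
  have h5 := h.decay n
  rw [tailSum] at h5
  have h6 := norm_sub_le_norm_add (t n • (e n (ω n) - e n (ω' n)))
    (∑' i, t (n + 1 + i) • (e (n + 1 + i) (ω (n + 1 + i)) - e (n + 1 + i) (ω' (n + 1 + i))))
  linarith

lemma agree_of_dist_lt (h : DigitSystem κ τ M t e) {n : ℕ} {ω ω' : ℕ → Fin N}
    (hd : dist (codePoint t e ω) (codePoint t e ω') < (1 - M) * τ * t n) :
    ∀ i < n + 1, ω i = ω' i := by
  intro i
  induction i using Nat.strong_induction_on with
  | _ i ih =>
    intro hi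
    by_contra hne
    have h1 := h.le_dist_codePoint (fun j hj => ih j hj (hj.trans hi)) hne
    have h2 := mul_le_mul_of_nonneg_left (h.antitone (Nat.lt_succ_iff.1 hi)) h.sigma_pos.le
    linarith

end DigitSystem

/-! ### Hausdorff measure of the sum set -/

namespace DigitSystem

variable {V : Type*} [NormedAddCommGroup V] [NormedSpace ℝ V] [CompleteSpace V]
  {N : ℕ} {κ τ M : ℝ} {t : ℕ → ℝ} {e : ℕ → Fin N → V}

lemma ediam_cylinder_le (h : DigitSystem κ τ M t e) (n : ℕ) (w : Fin n → Fin N) :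
    Metric.ediam (codePoint t e '' {ω | ∀ i : Fin n, ω i = w i}) ≤
      ENNReal.ofReal (2 * κ * t n) := by
  refine Metric.ediam_le ?_
  rintro _ ⟨ω, hω, rfl⟩ _ ⟨ω', hω', rfl⟩
  rw [edist_dist]
  exact ENNReal.ofReal_le_ofReal
    (h.dist_codePoint_le fun i hi => (hω ⟨i, hi⟩).trans (hω' ⟨i, hi⟩).symm)

lemma codeMeasure_preimage_le [NeZero N] (h : DigitSystem κ τ M t e) {n : ℕ} {s : Set V}
    (hs : ∀ x ∈ s, ∀ y ∈ s, dist x y < (1 - M) * τ * t n) :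
    codeMeasure N (codePoint t e ⁻¹' s) ≤ ((N : ℝ≥0∞) ^ (n + 1))⁻¹ := by
  rcases (codePoint t e ⁻¹' s).eq_empty_or_nonempty with he | ⟨ω', hω'⟩
  · simp [he]
  · rw [← codeMeasure_cylinder N (n + 1) ω']
    exact measure_mono fun ω hω => h.agree_of_dist_lt (hs _ hω _ hω')

variable [MeasurableSpace V] [BorelSpace V]

lemma hausdorffMeasure_range_le (h : DigitSystem κ τ M t e) {A K : ℝ} (hA : 0 < A)
    (hK : ∃ᶠ n in atTop, (N : ℝ) ^ n * t n ^ A ≤ K) :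
    μH[A] (range (codePoint t e)) ≤ ENNReal.ofReal ((2 * κ) ^ A * K) := by
  have hκ := h.kappa_pos
  refine (Measure.hausdorffMeasure_le_liminf_sum (l := atTop)
    (ι := fun n => Fin n → Fin N) A _ (fun n => ENNReal.ofReal (2 * κ * t n)) ?_
    (fun n w => codePoint t e '' {ω | ∀ i : Fin n, ω i = w i})
    (.of_forall fun n w => h.ediam_cylinder_le n w) (.of_forall fun n => ?_)).trans ?_
  · simpa using ENNReal.tendsto_ofReal (h.tendsto_zero.const_mul (2 * κ))
  · rintro _ ⟨ω, rfl⟩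
    exact mem_iUnion.2 ⟨fun i => ω i, ω, fun i => rfl, rfl⟩
  · refine liminf_le_of_frequently_le' (hK.mono fun n hn => ?_)
    refine (Finset.sum_le_sum fun w _ =>
      ENNReal.rpow_le_rpow (h.ediam_cylinder_le n w) hA.le).trans ?_
    have h0 : 0 ≤ 2 * κ * t n := by have := h.pos n; positivity
    rw [Finset.sum_const, ENNReal.ofReal_rpow_of_nonneg h0 hA.le, nsmul_eq_mul]
    simp only [Finset.card_univ, Fintype.card_fun, Fintype.card_fin]
    rw [← ENNReal.ofReal_natCast, ← ENNReal.ofReal_mul (by positivity)]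
    refine ENNReal.ofReal_le_ofReal ?_
    rw [Real.mul_rpow (by positivity) (h.pos n).le]
    push_cast
    calc (N : ℝ) ^ n * ((2 * κ) ^ A * t n ^ A) = (2 * κ) ^ A * ((N : ℝ) ^ n * t n ^ A) := by ring
      _ ≤ _ := by gcongr

/-- Mass distribution principle: a set of diameter in [σ t_(n+1), σ t_n) meets only one cylinder of
level n + 1, so its mass is at most N^(-(n+1)). -/
lemma le_hausdorffMeasure_range [NeZero N] (h : DigitSystem κ τ M t e) {A K : ℝ} (hA : 0 < A)
    (hK0 : 0 < K) (hK : ∀ᶠ n in atTop, K ≤ (N : ℝ) ^ n * t n ^ A) :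
    ENNReal.ofReal (((1 - M) * τ) ^ A * K) ≤ μH[A] (range (codePoint t e)) := by
  set σ := (1 - M) * τ with hσdef
  have hσ : 0 < σ := h.sigma_pos
  set μ := (codeMeasure N).map (codePoint t e) with hμ
  have hmeas : Measurable (codePoint t e) := h.continuous_codePoint.measurable
  have hN : (N : ℝ) ≠ 0 := Nat.cast_ne_zero.2 (NeZero.ne N)
  obtain ⟨m, hm⟩ := eventually_atTop.1 hK
  have key : (ENNReal.ofReal (σ ^ A * K) • μ) ≤ μH[A] := by
    refine Measure.le_hausdorffMeasure A _ (ENNReal.ofReal (σ * t m / 2))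
      (ENNReal.ofReal_pos.2 (by have := h.pos m; positivity)) fun s hs => ?_
    have hfin : Metric.ediam s ≠ ∞ := ne_top_of_le_ne_top ENNReal.ofReal_ne_top hs
    have hsx : Metric.ediam s = ENNReal.ofReal (Metric.diam s) :=
      (ENNReal.ofReal_toReal hfin).symm
    have hpre : ∀ n, Metric.diam s < σ * t n →
        μ s ≤ ((N : ℝ≥0∞) ^ (n + 1))⁻¹ := fun n hn => by
      -- The set need not be measurable; its closure is, and has the same diameter.
      refine (measure_mono subset_closure).trans ?_
      rw [hμ, Measure.map_apply hmeas isClosed_closure.measurableSet]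
      refine h.codeMeasure_preimage_le fun x hx y hy => lt_of_le_of_lt ?_ hn
      rw [← Metric.diam_closure]
      refine Metric.dist_le_diam_of_mem' ?_ hx hy
      rwa [Metric.ediam_closure]
    have hle : Metric.diam s ≤ σ * t m / 2 :=
      ENNReal.toReal_le_of_le_ofReal (by have := h.pos m; positivity) hs
    rw [Measure.smul_apply, smul_eq_mul]
    rcases (Metric.diam_nonneg (s := s)).eq_or_lt with h0 | h0
    -- Diameter zero matches no scale, but then the set lies in one cylinder of every level.
    · have hμ0 : μ s = 0 := by
        refine le_antisymm (ge_of_tendsto' (f := fun n : ℕ => ((N : ℝ≥0∞) ^ (n + 1))⁻¹)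
          (x := atTop) ?_ fun n => hpre n ?_) zero_le
        · have h2 : (1 : ℝ≥0∞) < N := by exact_mod_cast h.two_le
          have h3 := ENNReal.tendsto_pow_atTop_nhds_zero_of_lt_one (r := (N : ℝ≥0∞)⁻¹)
            (ENNReal.inv_lt_one.2 h2)
          simpa only [ENNReal.inv_pow, Function.comp_def] using h3.comp (tendsto_add_atTop_nat 1)
        · rw [← h0]; have := h.pos n; positivity
      simp [hμ0]
    · obtain ⟨n, hmn, hn1, hn2⟩ := h.exists_level h0 hσ (m := m)
        (by have := mul_pos hσ (h.pos m); linarith)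
      refine (mul_le_mul_right (hpre n hn2) _).trans ?_
      rw [hsx, ENNReal.ofReal_rpow_of_pos h0, ← ENNReal.ofReal_natCast,
        ← ENNReal.ofReal_pow (by positivity), ← ENNReal.ofReal_inv_of_pos (by positivity),
        ← ENNReal.ofReal_mul (by positivity)]
      refine ENNReal.ofReal_le_ofReal ?_
      have h5 := hm (n + 1) (by omega)
      have ht := (h.pos (n + 1)).le
      rw [← div_eq_mul_inv, div_le_iff₀ (by positivity)]
      calc σ ^ A * K ≤ σ ^ A * (N ^ (n + 1) * t (n + 1) ^ A) := by gcongr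
        _ = (σ * t (n + 1)) ^ A * N ^ (n + 1) := by
          rw [Real.mul_rpow hσ.le ht]; ring
        _ ≤ _ := by gcongr
  have h1 := key (range (codePoint t e))
  refine le_trans ?_ h1
  rw [Measure.smul_apply, smul_eq_mul]
  have h2 := Measure.le_map_apply (μ := codeMeasure N) hmeas.aemeasurable (range (codePoint t e))
  rw [preimage_range, measure_univ] at h2
  calc _ = ENNReal.ofReal (σ ^ A * K) * 1 := (mul_one _).symm
    _ ≤ _ := mul_le_mul_right h2 _

end DigitSystem

/-! ### Packing measure of the sum set -/

lemma packingPre_empty {X : Type*} [MetricSpace X] (d : ℝ) : packingPre d (∅ : Set X) = 0 := by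
  refine le_antisymm (iInf₂_le_of_le 1 one_pos (iSup₂_le fun F hF => ?_)) zero_le
  have : F = ∅ := eq_empty_of_forall_notMem fun q hq => (hF.1 q hq).1
  subst this
  simp

lemma packingMeasure_le_packingPre {X : Type*} [MetricSpace X] (d : ℝ) (E : Set X) :
    packingMeasure d E ≤ packingPre d E := by
  refine iInf₂_le_of_le (fun i => if i = 0 then E else ∅) (fun x hx => ?_) ?_
  · exact mem_iUnion.2 ⟨0, by simpa using hx⟩
  · rw [tsum_eq_single 0]
    · simp
    · intro i hi
      simp [hi, packingPre_empty]

lemma ediam_ball_eq {V : Type*} [NormedAddCommGroup V] [NormedSpace ℝ V] [Nontrivial V] (x : V) {r : ℝ} (hr : 0 ≤ r) :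
    Metric.ediam (Metric.ball x r) = ENNReal.ofReal (2 * r) := by
  rw [← Metric.diam_ball_eq x hr, Metric.diam,
    ENNReal.ofReal_toReal Metric.isBounded_ball.ediam_ne_top]

namespace DigitSystem

variable {V : Type*} [NormedAddCommGroup V] [NormedSpace ℝ V] [CompleteSpace V]
  {N : ℕ} {κ τ M : ℝ} {t : ℕ → ℝ} {e : ℕ → Fin N → V}

/-- Each ball of a packing contains a cylinder of comparable size, and disjoint balls have total
mass at most 1. -/
lemma packingMeasure_range_le [NeZero N] (h : DigitSystem κ τ M t e) {B K : ℝ} (hB : 0 < B)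
    (hK : ∀ᶠ n in atTop, (N : ℝ) ^ n * t n ^ B ≤ K) :
    packingMeasure B (range (codePoint t e)) ≤ ENNReal.ofReal ((8 * κ) ^ B * K * N) := by
  borelize V
  have hκ := h.kappa_pos
  have hN : (N : ℝ) ≠ 0 := Nat.cast_ne_zero.2 (NeZero.ne N)
  have hmeas : Measurable (codePoint t e) := h.continuous_codePoint.measurable
  obtain ⟨m, hm⟩ := eventually_atTop.1 hK
  have hm0 := h.pos m
  refine (packingMeasure_le_packingPre _ _).trans ?_
  refine iInf₂_le_of_le (κ * t m) (by positivity) (iSup₂_le fun F hF => ?_)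
  set C := ENNReal.ofReal ((8 * κ) ^ B * K * N)
  have key : ∀ q : F, Metric.ediam (Metric.ball (q : V × ℝ).1 (q : V × ℝ).2) ^ B ≤
      C * (codeMeasure N).map (codePoint t e) (Metric.ball (q : V × ℝ).1 (q : V × ℝ).2) := by
    rintro ⟨⟨x, ρ⟩, hq⟩
    obtain ⟨⟨ω, rfl⟩, hρ0, hρ⟩ := hF.1 _ hq
    simp only at hρ0 hρ ⊢
    -- Half the radius makes the level n + 1 cylinder fit strictly inside the open ball; the ball's
    -- diameter is then at most 8κ t_n.
    obtain ⟨n, hmn, hn1, hn2⟩ := h.exists_level (c := 2 * κ) (m := m) (half_pos hρ0)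
      (by positivity) (by nlinarith)
    have ht := h.pos n
    have hle : ((N : ℝ≥0∞) ^ (n + 1))⁻¹ ≤
        (codeMeasure N).map (codePoint t e) (Metric.ball (codePoint t e ω) ρ) := by
      rw [Measure.map_apply hmeas Metric.isOpen_ball.measurableSet,
        ← codeMeasure_cylinder N (n + 1) ω]
      exact measure_mono fun ω' hω' =>
        Metric.mem_ball.2 (by linarith [h.dist_codePoint_le hω'])
    refine le_trans ?_ (mul_le_mul_right hle _)
    have hd : Metric.ediam (Metric.ball (codePoint t e ω) ρ) ≤ ENNReal.ofReal (8 * κ * t n) := by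
      refine Metric.ediam_le fun x hx y hy => ?_
      rw [edist_dist]
      refine ENNReal.ofReal_le_ofReal ?_
      have h1 := dist_triangle_right x y (codePoint t e ω)
      have h2 := Metric.mem_ball.1 hx
      have h3 := Metric.mem_ball.1 hy
      linarith
    refine (ENNReal.rpow_le_rpow hd hB.le).trans ?_
    rw [ENNReal.ofReal_rpow_of_pos (by positivity), ← ENNReal.ofReal_natCast,
        ← ENNReal.ofReal_pow (by positivity), ← ENNReal.ofReal_inv_of_pos (by positivity),
        ← ENNReal.ofReal_mul' (by positivity)]
    refine ENNReal.ofReal_le_ofReal ?_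
    rw [← div_eq_mul_inv, le_div_iff₀ (by positivity), Real.mul_rpow (by positivity) ht.le]
    calc (8 * κ) ^ B * t n ^ B * N ^ (n + 1) = (8 * κ) ^ B * (N ^ n * t n ^ B) * N := by ring
      _ ≤ _ := by have := hm n hmn; gcongr
  calc _ ≤ ∑' q : F, C * (codeMeasure N).map (codePoint t e)
        (Metric.ball (q : V × ℝ).1 (q : V × ℝ).2) := ENNReal.tsum_le_tsum key
    _ = C * ∑' q : F, (codeMeasure N).map (codePoint t e)
        (Metric.ball (q : V × ℝ).1 (q : V × ℝ).2) := ENNReal.tsum_mul_left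
    _ ≤ C * 1 := by
      refine mul_le_mul_right ((tsum_meas_le_meas_iUnion_of_disjoint _
        (fun _ => Metric.isOpen_ball.measurableSet) ?_).trans ?_) _
      · exact fun q q' hqq => hF.2 q.2 q'.2 (Subtype.coe_injective.ne hqq)
      · rw [Measure.map_apply hmeas (isOpen_iUnion fun _ => Metric.isOpen_ball).measurableSet]
        exact prob_le_one
    _ = C := mul_one _

/-- Proved for arbitrary G, because the packing measure is an infimum over countable covers;
bounding by the mass of G lets the pieces be summed. -/
lemma le_packingPre [NeZero N] (h : DigitSystem κ τ M t e) {B K : ℝ} (hK0 : 0 < K)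
    (hK : ∃ᶠ n in atTop, K ≤ (N : ℝ) ^ n * t n ^ B) (G : Set V) :
    ENNReal.ofReal (((1 - M) * τ) ^ B * K) * codeMeasure N (codePoint t e ⁻¹' G) ≤
      packingPre B G := by
  set σ := (1 - M) * τ with hσdef
  have hσ : 0 < σ := h.sigma_pos
  have hN : (N : ℝ) ≠ 0 := Nat.cast_ne_zero.2 (NeZero.ne N)
  have h2 := h.two_le
  -- Needed for a ball of radius ρ to have diameter 2ρ.
  have : Nontrivial V := by
    refine nontrivial_of_ne (e 0 ⟨0, by omega⟩) (e 0 ⟨1, by omega⟩) (dist_pos.1 ?_)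
    exact h.tau_pos.trans_le (h.le_dist 0 _ _ (by simp))
  refine le_iInf₂ fun δ hδ => ?_
  have hev : ∀ᶠ n in atTop, σ * t n / 2 < δ := by
    have := (h.tendsto_zero.const_mul σ).div_const 2
    simp only [mul_zero, zero_div] at this
    exact this.eventually (gt_mem_nhds hδ)
  obtain ⟨n, hn, hnδ⟩ := (hK.and_eventually hev).exists
  have ht := h.pos n
  set ρ := σ * t n / 2 with hρ
  have hρ0 : 0 < ρ := by positivity
  let restr : (ℕ → Fin N) → Fin (n + 1) → Fin N := fun ω i => ω i
  -- The words of length n + 1 that G meets. One point per word gives centres σ t_n apart, and the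
  -- mass of G is at most |W| N^(-(n+1)).
  set W : Set (Fin (n + 1) → Fin N) := restr '' (codePoint t e ⁻¹' G) with hW
  have hchoose : ∀ w : W, ∃ ω, codePoint t e ω ∈ G ∧ restr ω = w := fun w => w.2
  choose pt hptG hptw using hchoose
  have hsep : ∀ w w' : W, w ≠ w' →
      2 * ρ ≤ dist (codePoint t e (pt w)) (codePoint t e (pt w')) := by
    intro w w' hww
    by_contra hlt
    have := h.agree_of_dist_lt (n := n) (ω := pt w) (ω' := pt w') (by linarith)
    refine hww (Subtype.ext ?_)
    rw [← hptw, ← hptw]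
    exact funext fun i => this i i.2
  let f : W → V × ℝ := fun w => (codePoint t e (pt w), ρ)
  have hf : Function.Injective f := fun w w' hww => by
    by_contra hne
    have h1 := hsep w w' hne
    have h3 : codePoint t e (pt w) = codePoint t e (pt w') := congrArg Prod.fst hww
    rw [h3, dist_self] at h1
    linarith
  have hpack : IsPacking δ G (range f) := by
    constructor
    · rintro _ ⟨w, rfl⟩
      exact ⟨hptG w, hρ0, hnδ.le⟩
    · rintro _ ⟨w, rfl⟩ _ ⟨w', rfl⟩ hne
      refine Metric.ball_disjoint_ball ?_
      have := hsep w w' fun hww => hne (by rw [hww])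
      simp only [f]
      linarith
  refine le_trans ?_ (le_iSup₂_of_le (range f) hpack le_rfl)
  rw [tsum_range (g := f) (f := fun q => Metric.ediam (Metric.ball q.1 q.2) ^ B) hf]
  simp only [f, ediam_ball_eq _ hρ0.le]
  have : Fintype W := Fintype.ofFinite _
  rw [tsum_fintype, Finset.sum_const, nsmul_eq_mul, Finset.card_univ]
  have hmeasure : codeMeasure N (codePoint t e ⁻¹' G) ≤
      Fintype.card W * ((N : ℝ≥0∞) ^ (n + 1))⁻¹ := by
    have hsub : codePoint t e ⁻¹' G ⊆ ⋃ w : W, {ω | ∀ i < n + 1, ω i = pt w i} := by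
      intro ω hω
      refine mem_iUnion.2 ⟨⟨restr ω, ω, hω, rfl⟩, fun i hi => ?_⟩
      exact (congrFun (hptw ⟨restr ω, ω, hω, rfl⟩) ⟨i, hi⟩).symm
    refine (measure_mono hsub).trans ((measure_iUnion_fintype_le _ _).trans ?_)
    simp only [codeMeasure_cylinder]
    rw [Finset.sum_const, nsmul_eq_mul, Finset.card_univ]
  refine (mul_le_mul_right hmeasure _).trans ?_
  rw [mul_left_comm]
  refine mul_le_mul_right ?_ _
  rw [ENNReal.ofReal_rpow_of_pos (by positivity), ← ENNReal.ofReal_natCast,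
    ← ENNReal.ofReal_pow (by positivity), ← ENNReal.ofReal_inv_of_pos (by positivity),
    ← ENNReal.ofReal_mul (by positivity)]
  refine ENNReal.ofReal_le_ofReal ?_
  rw [← div_eq_mul_inv, div_le_iff₀ (by positivity),
    show 2 * ρ = σ * t n by rw [hρ]; ring, Real.mul_rpow hσ.le ht.le]
  have hN1 : (1 : ℝ) ≤ N := by exact_mod_cast h2.trans' one_le_two
  calc σ ^ B * K ≤ σ ^ B * (N ^ n * t n ^ B) := by gcongr
    _ ≤ σ ^ B * (N ^ n * t n ^ B) * N := le_mul_of_one_le_right (by positivity) hN1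
    _ = _ := by ring

lemma le_packingMeasure_range [NeZero N] (h : DigitSystem κ τ M t e) {B K : ℝ}
    (hK0 : 0 < K) (hK : ∃ᶠ n in atTop, K ≤ (N : ℝ) ^ n * t n ^ B) :
    ENNReal.ofReal (((1 - M) * τ) ^ B * K) ≤ packingMeasure B (range (codePoint t e)) := by
  refine le_iInf₂ fun G hG => ?_
  refine le_trans ?_ (ENNReal.tsum_le_tsum fun i => h.le_packingPre hK0 hK (G i))
  rw [ENNReal.tsum_mul_left]
  have h1 : (1 : ℝ≥0∞) ≤ ∑' i, codeMeasure N (codePoint t e ⁻¹' G i) := by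
    rw [← measure_univ (μ := codeMeasure N)]
    refine (measure_mono ?_).trans (measure_iUnion_le _)
    rw [← preimage_iUnion]
    exact fun ω _ => hG ⟨ω, rfl⟩
  calc _ = ENNReal.ofReal (((1 - M) * τ) ^ B * K) * 1 := (mul_one _).symm
    _ ≤ _ := mul_le_mul_right h1 _

end DigitSystem

/-! ### Positivity and finiteness as growth conditions -/

/-- The asymptotic condition on `x n = -log_N (t n)` that characterizes a positive and finite
`A`-dimensional Hausdorff measure. -/
def HausdorffGrowth (A : ℝ) (x : ℕ → ℝ) : Prop :=
  (∃ K, ∀ᶠ n : ℕ in atTop, A * x n ≤ n + K) ∧ ∃ K, ∃ᶠ n : ℕ in atTop, n ≤ A * x n + K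

/-- The asymptotic condition on `x n = -log_N (t n)` that characterizes a positive and finite
`B`-dimensional packing measure. -/
def PackingGrowth (B : ℝ) (x : ℕ → ℝ) : Prop :=
  (∃ K, ∃ᶠ n : ℕ in atTop, B * x n ≤ n + K) ∧ ∃ K, ∀ᶠ n : ℕ in atTop, n ≤ B * x n + K

/-- The two estimates are complementary: where the upper one fails for K, the lower one applies.
This yields the converse implications. -/
lemma mem_Ioo_zero_top_iff {m : ℝ≥0∞} {U L : ℝ → Prop} {c c' : ℝ} (hc : 0 < c) (hc' : 0 < c')
    (hU : ∀ K, U K → m ≤ ENNReal.ofReal (c * K))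
    (hL : ∀ K, 0 < K → L K → ENNReal.ofReal (c' * K) ≤ m) (hUL : ∀ K, ¬ U K → L K) :
    m ∈ Ioo 0 ⊤ ↔ (∃ K, 0 < K ∧ L K) ∧ ∃ K, 0 < K ∧ U K := by
  constructor
  · rintro ⟨h0, h1⟩
    constructor
    · obtain ⟨r, hr0, hr⟩ := ENNReal.lt_iff_exists_nnreal_btwn.1 h0
      have hr0' : 0 < (r : ℝ) := by exact_mod_cast hr0
      refine ⟨r / c, by positivity, hUL _ fun hu => ?_⟩
      have := hU _ hu
      rw [mul_div_cancel₀ _ hc.ne', ENNReal.ofReal_coe_nnreal] at this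
      exact absurd this (not_le.2 hr)
    · obtain ⟨r, hr, -⟩ := ENNReal.lt_iff_exists_nnreal_btwn.1 h1
      refine ⟨(r + 1) / c', by positivity, by_contra fun hu => ?_⟩
      have h2 := hL _ (by positivity) (hUL _ hu)
      rw [mul_div_cancel₀ _ hc'.ne'] at h2
      have h3 : (r : ℝ≥0∞) ≤ ENNReal.ofReal (r + 1) := by
        rw [← ENNReal.ofReal_coe_nnreal]
        exact ENNReal.ofReal_le_ofReal (by linarith)
      exact absurd (h3.trans h2) (not_le.2 hr)
  · rintro ⟨⟨K, hK, hk⟩, K', -, hk'⟩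
    exact ⟨(ENNReal.ofReal_pos.2 (by positivity)).trans_le (hL K hK hk),
      (hU K' hk').trans_lt ENNReal.ofReal_lt_top⟩

lemma exists_pos_iff_exists_rpow {N : ℝ} (hN : 1 < N) {L : ℝ → Prop} :
    (∃ K, 0 < K ∧ L K) ↔ ∃ k : ℝ, L (N ^ k) := by
  constructor
  · rintro ⟨K, hK, h⟩
    exact ⟨Real.logb N K, by rwa [Real.rpow_logb (by linarith) hN.ne' hK]⟩
  · rintro ⟨k, h⟩
    exact ⟨_, by positivity, h⟩

lemma pow_mul_rpow_eq {N s : ℝ} (hN : 1 < N) (hs : 0 < s) (A : ℝ) (n : ℕ) :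
    N ^ n * s ^ A = N ^ ((n : ℝ) - A * -Real.logb N s) := by
  have h0 : 0 < N := by linarith
  conv_lhs => rw [← Real.rpow_logb h0 hN.ne' hs]
  rw [← Real.rpow_mul h0.le, ← Real.rpow_natCast, ← Real.rpow_add h0]
  congr 1; ring

namespace DigitSystem

variable {V : Type*} [NormedAddCommGroup V] [NormedSpace ℝ V] [CompleteSpace V]
  {N : ℕ} {κ τ M : ℝ} {t : ℕ → ℝ} {e : ℕ → Fin N → V}

lemma packingMeasure_mem_Ioo_iff (h : DigitSystem κ τ M t e) {B : ℝ} (hB : 0 < B) :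
    packingMeasure B (range (codePoint t e)) ∈ Ioo 0 ⊤ ↔
      PackingGrowth B fun n => -Real.logb N (t n) := by
  have h2 := h.two_le
  have : NeZero N := ⟨by omega⟩
  have hN : (1 : ℝ) < N := by exact_mod_cast h2
  have hκ := h.kappa_pos
  have hσ := h.sigma_pos
  rw [mem_Ioo_zero_top_iff (c := (8 * κ) ^ B * N) (c' := ((1 - M) * τ) ^ B)
    (U := fun K => ∀ᶠ n in atTop, (N : ℝ) ^ n * t n ^ B ≤ K)
    (L := fun K => ∃ᶠ n in atTop, K ≤ (N : ℝ) ^ n * t n ^ B) (by positivity) (by positivity)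
    (fun K hK => (h.packingMeasure_range_le hB hK).trans_eq (by ring_nf))
    (fun K hK hK' => h.le_packingMeasure_range hK hK')
    (fun K hK => (not_eventually.1 hK).mono fun n hn => (not_le.1 hn).le),
    exists_pos_iff_exists_rpow hN, exists_pos_iff_exists_rpow hN, PackingGrowth]
  simp only [fun n => pow_mul_rpow_eq hN (h.pos n) B n, Real.rpow_le_rpow_left_iff hN]
  constructor
  · rintro ⟨⟨k, hk⟩, k', hk'⟩
    exact ⟨⟨-k, hk.mono fun n hn => by linarith⟩, k', hk'.mono fun n hn => by linarith⟩
  · rintro ⟨⟨k, hk⟩, k', hk'⟩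
    exact ⟨⟨-k, hk.mono fun n hn => by linarith⟩, k', hk'.mono fun n hn => by linarith⟩

lemma hausdorffMeasure_mem_Ioo_iff [MeasurableSpace V] [BorelSpace V]
    (h : DigitSystem κ τ M t e) {A : ℝ} (hA : 0 < A) :
    μH[A] (range (codePoint t e)) ∈ Ioo 0 ⊤ ↔
      HausdorffGrowth A fun n => -Real.logb N (t n) := by
  have h2 := h.two_le
  have : NeZero N := ⟨by omega⟩
  have hN : (1 : ℝ) < N := by exact_mod_cast h2
  have hκ := h.kappa_pos
  have hσ := h.sigma_pos
  rw [mem_Ioo_zero_top_iff (c := (2 * κ) ^ A) (c' := ((1 - M) * τ) ^ A)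
    (U := fun K => ∃ᶠ n in atTop, (N : ℝ) ^ n * t n ^ A ≤ K)
    (L := fun K => ∀ᶠ n in atTop, K ≤ (N : ℝ) ^ n * t n ^ A) (by positivity) (by positivity)
    (fun K hK => h.hausdorffMeasure_range_le hA hK)
    (fun K hK hK' => h.le_hausdorffMeasure_range hA hK hK')
    (fun K hK => (not_frequently.1 hK).mono fun n hn => (not_le.1 hn).le),
    exists_pos_iff_exists_rpow hN, exists_pos_iff_exists_rpow hN, HausdorffGrowth]
  simp only [fun n => pow_mul_rpow_eq hN (h.pos n) A n, Real.rpow_le_rpow_left_iff hN]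
  constructor
  · rintro ⟨⟨k, hk⟩, k', hk'⟩
    exact ⟨⟨-k, hk.mono fun n hn => by linarith⟩, k', hk'.mono fun n hn => by linarith⟩
  · rintro ⟨⟨k, hk⟩, k', hk'⟩
    exact ⟨⟨-k, hk.mono fun n hn => by linarith⟩, k', hk'.mono fun n hn => by linarith⟩

end DigitSystem

/-! ### Subsequences along prescribed slopes -/

lemma strictMono_floor_mul {α : ℝ} (hα : 1 ≤ α) : StrictMono fun i : ℕ => ⌊α * i⌋₊ := by
  refine strictMono_nat_of_lt_succ fun i => Nat.succ_le_iff.1 ?_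
  rw [Nat.succ_eq_add_one, ← Nat.floor_add_one (by positivity)]
  exact Nat.floor_le_floor (by push_cast; linarith)

/-- A subsequence that stays below slope `A / a`, and infinitely often (at times in a certain
infinite set) lies on it, turns growth of exponent `A` into growth of exponent `a`. -/
lemma HausdorffGrowth.exists_times {A a : ℝ} (hA : 0 < A) (ha : 0 < a) {x : ℕ → ℝ}
    (hx : Monotone x) (h : HausdorffGrowth A x) :
    ∃ P : ℕ → Prop, (∃ᶠ j in atTop, P j) ∧ ∀ π : ℕ → ℕ, StrictMono π →
      (∀ i : ℕ, π i ≤ ⌊A / a * i⌋₊) → (∃ᶠ j : ℕ in atTop, P j ∧ π j = ⌊A / a * j⌋₊) →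
        HausdorffGrowth a (x ∘ π) := by
  obtain ⟨⟨K, hK⟩, K', hK'⟩ := h
  set α := A / a with hα
  have hα0 : 0 < α := by positivity
  have hAa : A = α * a := by rw [hα]; field_simp
  refine ⟨fun j => ∃ n : ℕ, n ≤ ⌊α * j⌋₊ ∧ α * j ≤ n + α ∧ n ≤ A * x n + K', ?_, ?_⟩
  · rw [frequently_atTop] at hK' ⊢
    intro L
    obtain ⟨n, hn, hnK⟩ := hK' ⌈α * L⌉₊
    have h1 : α * L ≤ n := Nat.ceil_le.1 hn
    have h2 : (n : ℝ) / α ≤ ⌈(n : ℝ) / α⌉₊ := Nat.le_ceil _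
    have h3 : (⌈(n : ℝ) / α⌉₊ : ℝ) < n / α + 1 := Nat.ceil_lt_add_one (by positivity)
    refine ⟨⌈(n : ℝ) / α⌉₊, ?_, n, ?_, ?_, hnK⟩
    · have : (L : ℝ) ≤ n / α := by rw [le_div_iff₀ hα0]; linarith
      exact_mod_cast this.trans h2
    · refine Nat.le_floor ?_
      rw [div_le_iff₀ hα0] at h2
      linarith
    · have h4 := (mul_lt_mul_iff_right₀ hα0).2 h3
      rw [mul_add, mul_div_cancel₀ _ hα0.ne'] at h4
      linarith
  · intro π hπ hle hfr
    refine ⟨⟨K / α, (hπ.tendsto_atTop.eventually hK).mono fun i hi => ?_⟩,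
      (α + K') / α, hfr.mono ?_⟩
    · have h1 : (π i : ℝ) ≤ α * i := (Nat.le_floor_iff (by positivity)).1 (hle i)
      refine le_of_mul_le_mul_left ?_ hα0
      rw [mul_add, mul_div_cancel₀ _ hα0.ne', Function.comp_apply, ← mul_assoc, ← hAa]
      linarith
    · rintro j ⟨⟨n, hn, hjn, hnK⟩, hπj⟩
      have h1 : x n ≤ x (π j) := hx (hn.trans_eq hπj.symm)
      refine le_of_mul_le_mul_left ?_ hα0
      rw [mul_add, mul_div_cancel₀ _ hα0.ne', Function.comp_apply, ← mul_assoc, ← hAa]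
      have := mul_le_mul_of_nonneg_left h1 hA.le
      linarith

/-- A subsequence that stays above slope `B / b`, and infinitely often (at times in a certain
infinite set) lies on it, turns growth of exponent `B` into growth of exponent `b`. -/
lemma PackingGrowth.exists_times {B b : ℝ} (hB : 0 < B) (hb : 0 < b) {x : ℕ → ℝ}
    (hx : Monotone x) (h : PackingGrowth B x) :
    ∃ Q : ℕ → Prop, (∃ᶠ j in atTop, Q j) ∧ ∀ π : ℕ → ℕ, StrictMono π →
      (∀ i : ℕ, ⌊B / b * i⌋₊ ≤ π i) → (∃ᶠ j : ℕ in atTop, Q j ∧ π j = ⌊B / b * j⌋₊) →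
        PackingGrowth b (x ∘ π) := by
  obtain ⟨⟨K, hK⟩, K', hK'⟩ := h
  set β := B / b with hβ
  have hβ0 : 0 < β := by positivity
  have hBb : B = β * b := by rw [hβ]; field_simp
  -- Here n / β is rounded down, since an upper bound on x (π j) is wanted.
  refine ⟨fun j => ∃ n : ℕ, ⌊β * j⌋₊ ≤ n ∧ n ≤ β * j + β ∧ B * x n ≤ n + K, ?_, ?_⟩
  · rw [frequently_atTop] at hK ⊢
    intro L
    obtain ⟨n, hn, hnK⟩ := hK ⌈β * L⌉₊
    have h1 : β * L ≤ n := Nat.ceil_le.1 hn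
    have h2 : (⌊(n : ℝ) / β⌋₊ : ℝ) ≤ n / β := Nat.floor_le (by positivity)
    have h3 : (n : ℝ) / β < ⌊(n : ℝ) / β⌋₊ + 1 := Nat.lt_floor_add_one _
    refine ⟨⌊(n : ℝ) / β⌋₊, ?_, n, ?_, ?_, hnK⟩
    · refine Nat.le_floor ?_
      rw [le_div_iff₀ hβ0]; linarith
    · refine Nat.floor_le_of_le ?_
      rw [le_div_iff₀ hβ0] at h2
      linarith
    · rw [div_lt_iff₀ hβ0] at h3
      linarith
  · intro π hπ hle hfr
    refine ⟨⟨(β + K) / β, hfr.mono ?_⟩,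
      (1 + K') / β, (hπ.tendsto_atTop.eventually hK').mono fun i hi => ?_⟩
    · rintro j ⟨⟨n, hn, hjn, hnK⟩, hπj⟩
      have h1 : x (π j) ≤ x n := hx (hπj.trans_le hn)
      refine le_of_mul_le_mul_left ?_ hβ0
      rw [mul_add, mul_div_cancel₀ _ hβ0.ne', Function.comp_apply, ← mul_assoc, ← hBb]
      have := mul_le_mul_of_nonneg_left h1 hB.le
      linarith
    · have h1 : β * i < π i + 1 := (Nat.lt_floor_add_one _).trans_le
        (by exact_mod_cast Nat.succ_le_succ (hle i))
      refine le_of_mul_le_mul_left ?_ hβ0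
      rw [mul_add, mul_div_cancel₀ _ hβ0.ne', Function.comp_apply, ← mul_assoc, ← hBb]
      linarith

/-- A strictly increasing sequence between the slopes `β ≤ α` that returns to either slope
infinitely often, at times from prescribed infinite sets. -/
lemma exists_strictMono_between_slopes {α β : ℝ} (hβ : 1 < β) (hβα : β ≤ α) {P Q : ℕ → Prop}
    (hP : ∃ᶠ j in atTop, P j) (hQ : ∃ᶠ j in atTop, Q j) :
    ∃ π : ℕ → ℕ, StrictMono π ∧ (∀ i : ℕ, π i ≤ ⌊α * i⌋₊) ∧ (∀ i : ℕ, ⌊β * i⌋₊ ≤ π i) ∧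
      (∃ᶠ j : ℕ in atTop, P j ∧ π j = ⌊α * j⌋₊) ∧ ∃ᶠ j : ℕ in atTop, Q j ∧ π j = ⌊β * j⌋₊ := by
  rw [frequently_atTop] at hP hQ
  choose p hpL hp using hP
  choose q hqL hq using hQ
  have hβ0 : 0 < β - 1 := by linarith
  -- From time F j on, the line of slope 1 through (j, αj) lies below slope β. This is where β > 1
  -- is needed.
  let F : ℕ → ℕ := fun j => ⌈((α - 1) * j + 1) / (β - 1)⌉₊
  have hF : ∀ j : ℕ, (α - 1) * j + 1 ≤ (β - 1) * F j := fun j => by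
    have := Nat.le_ceil (((α - 1) * j + 1) / (β - 1))
    rw [div_le_iff₀ hβ0] at this
    linarith
  have hFj : ∀ j, j ≤ F j := fun j => by
    have h1 := hF j
    have h2 : (0 : ℝ) ≤ (α - β) * j := mul_nonneg (by linarith) (Nat.cast_nonneg _)
    have : (j : ℝ) ≤ F j := le_of_mul_le_mul_left (by linarith) hβ0
    exact_mod_cast this
  obtain ⟨T, hT0, hT⟩ : ∃ T : ℕ → ℕ, T 0 = p 0 ∧ ∀ k, T (k + 1) = p (q (F (T k)) + 1) :=
    ⟨fun k => Nat.rec (motive := fun _ => ℕ) (p 0) (fun _ j => p (q (F j) + 1)) k, rfl,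
      fun _ => rfl⟩
  have hTP : ∀ k, P (T k) := fun k => by
    cases k with
    | zero => exact hT0 ▸ hp 0
    | succ k => exact hT k ▸ hp _
  have hTq : ∀ k, q (F (T k)) < T (k + 1) := fun k => by rw [hT]; exact hpL _
  have hqF : ∀ k, T k ≤ q (F (T k)) := fun k => (hFj _).trans (hqL _)
  have hTm : StrictMono T := strictMono_nat_of_lt_succ fun k => (hqF k).trans_lt (hTq k)
  let S : ℕ → Finset ℕ := fun i => (Finset.range (i + 1)).filter fun k => T k ≤ i
  have hS : ∀ i k, k ∈ S i ↔ T k ≤ i := fun i k => by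
    simp only [S, Finset.mem_filter, Finset.mem_range, and_iff_right_iff_imp]
    intro hk
    have := hTm.le_apply (x := k)
    omega
  -- At each time T k the sequence jumps to slope α, then grows by single steps until slope β
  -- overtakes it.
  let π : ℕ → ℕ := fun i =>
    max ⌊β * i⌋₊ ((S i).sup fun k => ⌊α * (T k : ℝ)⌋₊ + (i - T k))
  have hα0 : 0 ≤ α := by linarith
  have hup : ∀ i : ℕ, π i ≤ ⌊α * i⌋₊ := fun i => by
    refine max_le (Nat.floor_le_floor (by gcongr)) (Finset.sup_le fun k hk => ?_)
    rw [hS] at hk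
    refine Nat.le_floor ?_
    rw [Nat.cast_add, Nat.cast_sub hk]
    have h1 : (⌊α * (T k : ℝ)⌋₊ : ℝ) ≤ α * T k := Nat.floor_le (by positivity)
    have h2 : (0 : ℝ) ≤ (α - 1) * (i - T k) :=
      mul_nonneg (by linarith) (sub_nonneg.2 (by exact_mod_cast hk))
    linarith
  refine ⟨π, strictMono_nat_of_lt_succ fun i => max_lt ?_ ?_, hup, fun i => le_max_left _ _,
    ?_, ?_⟩
  · exact (strictMono_floor_mul hβ.le (Nat.lt_succ_self i)).trans_le (le_max_left _ _)
  · refine (Finset.sup_lt_iff ?_).2 fun k hk => ?_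
    · exact (Nat.zero_le _).trans_lt ((strictMono_floor_mul hβ.le (Nat.lt_succ_self i)).trans_le
        (le_max_left _ _))
    · rw [hS] at hk
      refine lt_of_lt_of_le ?_ ((Finset.le_sup (f := fun k => ⌊α * (T k : ℝ)⌋₊ + (i + 1 - T k))
        ((hS (i + 1) k).2 (by omega))).trans (le_max_right _ _))
      omega
  · refine frequently_atTop.2 fun L => ⟨T L, hTm.le_apply, hTP L, (hup _).antisymm ?_⟩
    refine le_trans ?_ ((Finset.le_sup (f := fun k => ⌊α * (T k : ℝ)⌋₊ + (T L - T k))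
        ((hS (T L) L).2 le_rfl)).trans (le_max_right _ _))
    exact Nat.le_add_right _ _
  -- This time precedes T (L + 1), so only the lines started at T 0, ..., T L compete, and all have
  -- dropped below slope β.
  · refine frequently_atTop.2 fun L => ⟨q (F (T L)), hTm.le_apply.trans (hqF L), hq _,
      max_eq_left (Finset.sup_le fun k hk => ?_)⟩
    rw [hS] at hk
    have hkL : k ≤ L := Nat.lt_succ_iff.1 (hTm.lt_iff_lt.1 (hk.trans_lt (hTq L)))
    refine Nat.le_floor ?_
    rw [Nat.cast_add, Nat.cast_sub hk]
    have h1 : (⌊α * (T k : ℝ)⌋₊ : ℝ) ≤ α * T k := Nat.floor_le (by positivity)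
    have h2 : (T k : ℝ) ≤ T L := by exact_mod_cast hTm.monotone hkL
    have h3 := mul_le_mul_of_nonneg_left h2 (show 0 ≤ α - 1 by linarith)
    have h4 := hF (T L)
    have h5 : ((F (T L) : ℕ) : ℝ) ≤ q (F (T L)) := by exact_mod_cast hqL _
    have h6 := mul_le_mul_of_nonneg_left h5 hβ0.le
    linarith

/-! ### From digit sets to codes -/

namespace SumSetData

variable {p N : ℕ} {s : ℕ → ℝ} {D : ℕ → Finset (EuclideanSpace ℝ (Fin p))}

lemma diam_le (h : SumSetData N s D) (n : ℕ) :
    Metric.diam (D n : Set (EuclideanSpace ℝ (Fin p))) ≤ digitKappa D :=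
  le_ciSup h.kappa_finite n

lemma dist_le (h : SumSetData N s D) {n : ℕ} {d d' : EuclideanSpace ℝ (Fin p)} (hd : d ∈ D n)
    (hd' : d' ∈ D n) : dist d d' ≤ digitKappa D :=
  (Metric.dist_le_diam_of_mem (D n).finite_toSet.isBounded hd hd').trans (h.diam_le n)

lemma le_dist {n : ℕ} {d d' : EuclideanSpace ℝ (Fin p)} (hd : d ∈ D n)
    (hd' : d' ∈ D n) (hne : d ≠ d') : digitTau D ≤ dist d d' := by
  refine (ciInf_le ⟨0, ?_⟩ n).trans (infsep_le_dist_of_mem hd hd' hne)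
  rintro _ ⟨n, rfl⟩
  exact infsep_nonneg

/-- The left side is a subsum of the right, so the decay condition passes to subsequences with the
same M. -/
lemma tailSum_comp_le (h : SumSetData N s D) {π : ℕ → ℕ} (hπ : StrictMono π) (n : ℕ) :
    tailSum (s ∘ π) n ≤ tailSum s (π n) := by
  have hs : ∀ m, Summable fun i => s (m + i) := fun m => by
    simpa [add_comm] using (summable_nat_add_iff m).2 h.summable
  have hs' : Summable fun i => (s ∘ π) (n + 1 + i) :=
    h.summable.comp_injective (hπ.injective.comp (add_right_injective _))
  have hge : ∀ i, π n + 1 ≤ π (n + 1 + i) := fun i => hπ (by omega)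
  refine hs'.tsum_le_tsum_of_inj (fun i => π (n + 1 + i) - (π n + 1)) ?_
    (fun _ _ => (h.pos _).le) (fun i => ?_) (hs _)
  · intro i j hij
    have h1 := hge i
    have h2 := hge j
    have : π (n + 1 + i) = π (n + 1 + j) := by simp only at hij; omega
    have := hπ.injective this
    omega
  · simp only [Function.comp_apply]
    rw [Nat.add_sub_cancel' (hge i)]

/-- An enumeration of the digits. -/
noncomputable def digit (h : SumSetData N s D) (n : ℕ) (k : Fin N) : EuclideanSpace ℝ (Fin p) :=
  ((D n).equivFinOfCardEq (h.card_eq n)).symm k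

lemma digit_mem (h : SumSetData N s D) (n : ℕ) (k : Fin N) : h.digit n k ∈ D n :=
  (((D n).equivFinOfCardEq (h.card_eq n)).symm k).2

lemma digit_injective (h : SumSetData N s D) (n : ℕ) : Function.Injective (h.digit n) :=
  Subtype.coe_injective.comp (Equiv.injective _)

lemma exists_digit_eq (h : SumSetData N s D) {n : ℕ} {d : EuclideanSpace ℝ (Fin p)}
    (hd : d ∈ D n) : ∃ k, h.digit n k = d :=
  ⟨(D n).equivFinOfCardEq (h.card_eq n) ⟨d, hd⟩, by simp [digit]⟩

/-- Separate maps for scales and digits: ρ = π and ρ = id give the two choices of digit sets. -/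
lemma exists_digitSystem (h : SumSetData N s D) : ∃ M, ∀ π : ℕ → ℕ, StrictMono π → ∀ ρ : ℕ → ℕ,
    DigitSystem (digitKappa D) (digitTau D) M (s ∘ π) fun n => h.digit (ρ n) := by
  obtain ⟨M, hM, hdecay⟩ := h.decay
  refine ⟨M, fun π hπ ρ => ⟨h.two_le, fun n => h.pos _, h.summable.comp_injective hπ.injective,
    fun n k => ?_, fun n k l => h.dist_le (h.digit_mem _ k) (h.digit_mem _ l), fun n k l hkl =>
    le_dist (h.digit_mem _ k) (h.digit_mem _ l) ((h.digit_injective _).ne hkl), h.tau_pos, hM,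
    fun n => ?_⟩⟩
  · rw [← dist_zero_right]
    exact h.dist_le (h.digit_mem _ k) (h.zero_mem _)
  · have h1 := hdecay (π n)
    rw [div_le_iff₀ (mul_pos h.tau_pos (h.pos _))] at h1
    exact (mul_le_mul_of_nonneg_left (h.tailSum_comp_le hπ n)
      (Metric.diam_nonneg.trans (h.diam_le 0))).trans h1

lemma range_codePoint (h : SumSetData N s D) {π : ℕ → ℕ} (hπ : StrictMono π) (ρ : ℕ → ℕ) :
    range (codePoint (s ∘ π) fun n => h.digit (ρ n)) = sumSet (s ∘ π) (D ∘ ρ) := by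
  obtain ⟨M, hM⟩ := h.exists_digitSystem
  ext x
  constructor
  · rintro ⟨ω, rfl⟩
    exact ⟨fun i => h.digit (ρ i) (ω i), fun i => h.digit_mem _ _,
      ((hM π hπ ρ).summable_smul ω).hasSum⟩
  · rintro ⟨b, hb, hx⟩
    choose ω hω using fun i => h.exists_digit_eq (hb i)
    refine ⟨ω, ?_⟩
    rw [codePoint, ← hx.tsum_eq]
    simp only [hω]

lemma hausdorffMeasure_mem_Ioo_iff (h : SumSetData N s D) {π : ℕ → ℕ} (hπ : StrictMono π)
    (ρ : ℕ → ℕ) {A : ℝ} (hA : 0 < A) : μH[A] (sumSet (s ∘ π) (D ∘ ρ)) ∈ Ioo 0 ⊤ ↔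
      HausdorffGrowth A ((fun n => -Real.logb N (s n)) ∘ π) := by
  obtain ⟨M, hM⟩ := h.exists_digitSystem
  rw [← h.range_codePoint hπ ρ]
  exact (hM π hπ ρ).hausdorffMeasure_mem_Ioo_iff hA

lemma packingMeasure_mem_Ioo_iff (h : SumSetData N s D) {π : ℕ → ℕ} (hπ : StrictMono π)
    (ρ : ℕ → ℕ) {B : ℝ} (hB : 0 < B) : packingMeasure B (sumSet (s ∘ π) (D ∘ ρ)) ∈ Ioo 0 ⊤ ↔
      PackingGrowth B ((fun n => -Real.logb N (s n)) ∘ π) := by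
  obtain ⟨M, hM⟩ := h.exists_digitSystem
  rw [← h.range_codePoint hπ ρ]
  exact (hM π hπ ρ).packingMeasure_mem_Ioo_iff hB

lemma monotone_neg_logb (h : SumSetData N s D) : Monotone fun n => -Real.logb N (s n) := by
  obtain ⟨M, hM⟩ := h.exists_digitSystem
  have hN : (1 : ℝ) < N := by exact_mod_cast h.two_le
  intro m n hmn
  exact neg_le_neg (Real.logb_le_logb_of_le hN (h.pos n) ((hM id strictMono_id id).antitone hmn))

end SumSetData

theorem theorem6 {p N : ℕ} (s : ℕ → ℝ) (D : ℕ → Finset (EuclideanSpace ℝ (Fin p)))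
    (hsD : SumSetData N s D) :
    (∀ A : ℝ, μH[A] (sumSet s D) ∈ Ioo 0 ⊤ →
      ∀ a : ℝ, 0 < a → a ≤ A →
        ∃ π : ℕ → ℕ, StrictMono π ∧
          μH[a] (sumSet (s ∘ π) (D ∘ π)) ∈ Ioo 0 ⊤ ∧
          μH[a] (sumSet (s ∘ π) D) ∈ Ioo 0 ⊤) ∧
    (∀ B : ℝ, packingMeasure B (sumSet s D) ∈ Ioo 0 ⊤ →
      ∀ b : ℝ, 0 < b → b ≤ B →
        ∃ π : ℕ → ℕ, StrictMono π ∧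
          packingMeasure b (sumSet (s ∘ π) (D ∘ π)) ∈ Ioo 0 ⊤ ∧
          packingMeasure b (sumSet (s ∘ π) D) ∈ Ioo 0 ⊤) ∧
    (∀ A B : ℝ, μH[A] (sumSet s D) ∈ Ioo 0 ⊤ → packingMeasure B (sumSet s D) ∈ Ioo 0 ⊤ →
      ∀ a b : ℝ, 0 < a → a ≤ A → 0 < b → b ≤ B → a / A ≤ b / B → (b = B → a = A) →
        ∃ π : ℕ → ℕ, StrictMono π ∧
          (μH[a] (sumSet (s ∘ π) (D ∘ π)) ∈ Ioo 0 ⊤ ∧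
            packingMeasure b (sumSet (s ∘ π) (D ∘ π)) ∈ Ioo 0 ⊤) ∧
          (μH[a] (sumSet (s ∘ π) D) ∈ Ioo 0 ⊤ ∧
            packingMeasure b (sumSet (s ∘ π) D) ∈ Ioo 0 ⊤)) := by
  set x : ℕ → ℝ := fun n => -Real.logb N (s n)
  have hx : Monotone x := hsD.monotone_neg_logb
  have hH0 : ∀ {A : ℝ}, 0 < A → μH[A] (sumSet s D) ∈ Ioo 0 ⊤ → HausdorffGrowth A x :=
    fun hA h => (hsD.hausdorffMeasure_mem_Ioo_iff strictMono_id id hA).1 h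
  have hP0 : ∀ {B : ℝ}, 0 < B → packingMeasure B (sumSet s D) ∈ Ioo 0 ⊤ → PackingGrowth B x :=
    fun hB h => (hsD.packingMeasure_mem_Ioo_iff strictMono_id id hB).1 h
  refine ⟨fun A hA a ha haA => ?_, fun B hB b hb hbB => ?_,
    fun A B hA hB a b ha haA hb hbB hab hbB' => ?_⟩
  · have hA0 := ha.trans_le haA
    obtain ⟨P, hP, h⟩ := (hH0 hA0 hA).exists_times hA0 ha hx
    have hπ := strictMono_floor_mul ((one_le_div ha).2 haA)
    have hg := h _ hπ (fun _ => le_rfl) (hP.mono fun j hj => ⟨hj, rfl⟩)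
    exact ⟨_, hπ, (hsD.hausdorffMeasure_mem_Ioo_iff hπ _ ha).2 hg,
      (hsD.hausdorffMeasure_mem_Ioo_iff hπ id ha).2 hg⟩
  · have hB0 := hb.trans_le hbB
    obtain ⟨Q, hQ, h⟩ := (hP0 hB0 hB).exists_times hB0 hb hx
    have hπ := strictMono_floor_mul ((one_le_div hb).2 hbB)
    have hg := h _ hπ (fun _ => le_rfl) (hQ.mono fun j hj => ⟨hj, rfl⟩)
    exact ⟨_, hπ, (hsD.packingMeasure_mem_Ioo_iff hπ _ hb).2 hg,
      (hsD.packingMeasure_mem_Ioo_iff hπ id hb).2 hg⟩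
  · have hA0 := ha.trans_le haA
    have hB0 := hb.trans_le hbB
    obtain ⟨P, hP, hPg⟩ := (hH0 hA0 hA).exists_times hA0 ha hx
    obtain ⟨Q, hQ, hQg⟩ := (hP0 hB0 hB).exists_times hB0 hb hx
    have hslope : B / b ≤ A / a := by
      rw [div_le_div_iff₀ hA0 hB0] at hab
      rw [div_le_div_iff₀ hb ha]
      linarith
    obtain ⟨π, hπ, h1, h2, h3, h4⟩ : ∃ π : ℕ → ℕ, StrictMono π ∧ (∀ i : ℕ, π i ≤ ⌊A / a * i⌋₊) ∧
        (∀ i : ℕ, ⌊B / b * i⌋₊ ≤ π i) ∧ (∃ᶠ j : ℕ in atTop, P j ∧ π j = ⌊A / a * j⌋₊) ∧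
        ∃ᶠ j : ℕ in atTop, Q j ∧ π j = ⌊B / b * j⌋₊ := by
      -- Equal slopes need no oscillation, which covers b = B. If they differ, then b < B, so the
      -- lower slope exceeds 1.
      rcases hslope.eq_or_lt with heq | hlt
      · refine ⟨_, strictMono_floor_mul ((one_le_div ha).2 haA), fun _ => le_rfl, fun i => ?_,
          hP.mono fun j hj => ⟨hj, rfl⟩, hQ.mono fun j hj => ⟨hj, ?_⟩⟩
        · simp only [heq, le_refl]
        · simp only [heq]
      · have hbB1 : b < B := by
          refine hbB.lt_of_ne fun hbB2 => ?_
          rw [hbB' hbB2, hbB2, div_self hA0.ne', div_self hB0.ne'] at hlt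
          exact lt_irrefl _ hlt
        exact exists_strictMono_between_slopes ((one_lt_div hb).2 hbB1) hslope hP hQ
    have hg := hPg π hπ h1 h3
    have hg' := hQg π hπ h2 h4
    exact ⟨π, hπ, ⟨(hsD.hausdorffMeasure_mem_Ioo_iff hπ _ ha).2 hg,
      (hsD.packingMeasure_mem_Ioo_iff hπ _ hb).2 hg'⟩,
      (hsD.hausdorffMeasure_mem_Ioo_iff hπ id ha).2 hg,
      (hsD.packingMeasure_mem_Ioo_iff hπ id hb).2 hg'⟩
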